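/- Let $M_k$ be the space of complex $k\times k$ matrices with the inner product $\langle C,D\rangle=\operatorname{tr}(CD^*)$, and identify $M_k\otimes M_m$ with $M_{km}$ via the Kronecker product. A Hermitian Schmidt decomposition of a matrix $A\in M_k\otimes M_m$ is an expression $A=\sum_{i=1}^n\lambda_i\,\gamma_i\otimes\delta_i$ with real $\lambda_i>0$ and orthonormal families $(\gamma_i)$ in $M_k$, $(\delta_i)$ in $M_m$ of Hermitian matrices. A positive semidefinite Hermitian matrix $A\in M_k\otimes M_k$ is SPC if it has a Hermitian Schmidt decomposition $\sum_{i=1}^n\lambda_i\,\gamma_i\otimes\gamma_i$. A positive semidefinite Hermitian matrix $A\in M_k\otimes M_m$ is weak irreducible if, whenever $V_1,V_2\in M_k$ and $W_1,W_2\in M_m$ are Hermitian projections with $V_1V_2=0$, $W_1W_2=0$, $V_1+V_2=\mathrm{Id}$, $W_1+W_2=\mathrm{Id}$ and $A=\sum_{i=1}^2(V_i\otimes W_i)A(V_i\otimes W_i)$, one has $(V_1\otimes W_1)A(V_1\otimes W_1)=0$ or $(V_2\otimes W_2)A(V_2\otimes W_2)=0$. The matrix $A$ is separable if $A=\sum_{j=1}^r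 C_j\otimes D_j$ with $C_j\in M_k$ and $D_j\in M_m$ positive semidefinite Hermitian. (1) Let $A\in M_k\otimes M_k$ be a weak irreducible SPC matrix, let $A=\sum_{i=1}^n\lambda_i\,\gamma_i\otimes\gamma_i$ ($n\ge 1$) be a Hermitian Schmidt decomposition with $\lambda_1\ge\dots\ge\lambda_n>0$, and let $\mu$ be the least positive eigenvalue of $\gamma_1\otimes\gamma_1$. If $$\frac{\lambda_1\mu}{\lambda_2+\dots+\lambda_n}\ \ge\ \frac12$$ (a condition regarded as satisfied when $n=1$), then $A$ is separable. (2) The inequality is sharp in $M_2\otimes M_2$ in the following sense. Let $\gamma_1=\frac1{\sqrt2}\mathrm{Id},\gamma_2,\gamma_3,\gamma_4$ be the orthonormal Pauli basis of $M_2$ (the identity and the three Pauli matrices, each divided by $\sqrt2$). The least positive eigenvalue of $\gamma_1\otimes\gamma_1$ is $\mu=\frac12$, and for all $\lambda_1,\lambda_2,\lambda_3,\lambda_4>0$ the expression $A=\sum_{i=1}^4\lambda_i\,\gamma_i\otimes\gamma_i$ is a Hermitian Schmidt decomposition, and $A$ is separable if and only if $$\frac{\lambda_1\mu}{\lambda_2+\lambda_3+\lambda_4}\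 \ge\ \frac12 .$$ -/

import Mathlib

open scoped Kronecker ComplexOrder

namespace Bipartite

/-- A matrix in `M_k ⊗ M_m`, identified through the Kronecker product with a square matrix
indexed by `Fin k × Fin m`. -/
abbrev TMat (k m : ℕ) : Type := Matrix (Fin k × Fin m) (Fin k × Fin m) ℂ

/-- A finite family of matrices that is orthonormal for the inner product
`⟨C, D⟩ = tr (C D*)`. -/
def IsOrthonormalFamily {k n : ℕ} (γ : Fin n → Matrix (Fin k) (Fin k) ℂ) : Prop :=
  ∀ i j, (γ i * (γ j).conjTranspose).trace = if i = j then 1 else 0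

/-- `A = ∑ i, c i • (γ i ⊗ δ i)` is a Hermitian Schmidt decomposition of `A`: the coefficients
are positive reals, and `γ` and `δ` are orthonormal families of Hermitian matrices. -/
structure IsHermitianSchmidt {k m n : ℕ} (A : TMat k m) (c : Fin n → ℝ)
    (γ : Fin n → Matrix (Fin k) (Fin k) ℂ) (δ : Fin n → Matrix (Fin m) (Fin m) ℂ) : Prop where
  coeff_pos : ∀ i, 0 < c i
  left_hermitian : ∀ i, (γ i).IsHermitian
  right_hermitian : ∀ i, (δ i).IsHermitian
  left_orthonormal : IsOrthonormalFamily γ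
  right_orthonormal : IsOrthonormalFamily δ
  eq_sum : A = ∑ i, (c i : ℂ) • (γ i ⊗ₖ δ i)

/-- `A` is symmetric with positive coefficients (SPC): it is positive semidefinite Hermitian and
has a Hermitian Schmidt decomposition `∑ i, c i • (γ i ⊗ γ i)`. -/
def IsSPC {k : ℕ} (A : TMat k k) : Prop :=
  A.PosSemidef ∧
    ∃ (n : ℕ) (c : Fin n → ℝ) (γ : Fin n → Matrix (Fin k) (Fin k) ℂ),
      IsHermitianSchmidt A c γ γ

/-- `A` is weak irreducible: it is positive semidefinite Hermitian, and whenever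
`A = (V₁ ⊗ W₁) A (V₁ ⊗ W₁) + (V₂ ⊗ W₂) A (V₂ ⊗ W₂)` for complementary Hermitian projections
`V₁, V₂` and complementary Hermitian projections `W₁, W₂`, one of the two summands vanishes. -/
def IsWeakIrreducible {k m : ℕ} (A : TMat k m) : Prop :=
  A.PosSemidef ∧
    ∀ (V₁ V₂ : Matrix (Fin k) (Fin k) ℂ) (W₁ W₂ : Matrix (Fin m) (Fin m) ℂ),
      IsStarProjection V₁ → IsStarProjection V₂ → IsStarProjection W₁ → IsStarProjection W₂ →
      V₁ * V₂ = 0 → W₁ * W₂ = 0 → V₁ + V₂ = 1 → W₁ + W₂ = 1 →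
      A = (V₁ ⊗ₖ W₁) * A * (V₁ ⊗ₖ W₁) + (V₂ ⊗ₖ W₂) * A * (V₂ ⊗ₖ W₂) →
      (V₁ ⊗ₖ W₁) * A * (V₁ ⊗ₖ W₁) = 0 ∨ (V₂ ⊗ₖ W₂) * A * (V₂ ⊗ₖ W₂) = 0

/-- `A` is separable: it is a finite sum of tensor products of positive semidefinite Hermitian
matrices. -/
def IsSeparable {k m : ℕ} (A : TMat k m) : Prop :=
  ∃ (n : ℕ) (C : Fin n → Matrix (Fin k) (Fin k) ℂ) (D : Fin n → Matrix (Fin m) (Fin m) ℂ),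
    (∀ i, (C i).PosSemidef) ∧ (∀ i, (D i).PosSemidef) ∧ A = ∑ i, C i ⊗ₖ D i

/-- `μ` is the least positive eigenvalue of the matrix `B`. -/
def IsLeastPosEigenvalue {k m : ℕ} (B : TMat k m) (μ : ℝ) : Prop :=
  IsLeast {x : ℝ | 0 < x ∧ Module.End.HasEigenvalue (Matrix.toLin' B) (x : ℂ)} μ

/-- The orthonormal Pauli basis of `M_2`: the identity and the three Pauli matrices, each divided
by `√2`. -/
noncomputable def normalizedPauli : Fin 4 → Matrix (Fin 2) (Fin 2) ℂ :=
  ![((Real.sqrt 2 : ℝ) : ℂ)⁻¹ • !![1, 0; 0, 1],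
    ((Real.sqrt 2 : ℝ) : ℂ)⁻¹ • !![0, 1; 1, 0],
    ((Real.sqrt 2 : ℝ) : ℂ)⁻¹ • !![0, -Complex.I; Complex.I, 0],
    ((Real.sqrt 2 : ℝ) : ℂ)⁻¹ • !![1, 0; 0, -1]]

/-- The matrix `∑ i, c i • (γ i ⊗ γ i)` in `M_2 ⊗ M_2`, with `γ` the orthonormal Pauli basis. -/
noncomputable def pauliMatrix (c : Fin 4 → ℝ) : TMat 2 2 :=
  ∑ i, (c i : ℂ) • (normalizedPauli i ⊗ₖ normalizedPauli i)

end Bipartite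

/-!
Positive semidefiniteness of `A = ∑ i, λ i • (γ i ⊗ γ i)` means in particular that
`tr (A (P ⊗ N)) ≥ 0` for positive semidefinite `P` and `N`, i.e. that the self-adjoint map
`G : X ↦ ∑ i, λ i • tr (γ i X) • γ i`, of norm `λ₁`, is positive. A Perron–Frobenius argument
applies: if `γ₁ = P - N` with `P N = 0`, then `⟨G (P + N), P + N⟩ ≥ ⟨G γ₁, γ₁⟩ = λ₁ ‖P + N‖²`, so
`P + N`, and hence `P`, is an eigenvector of `G` for `λ₁`. The range projection `V` of a positive
semidefinite eigenvector `P` satisfies `tr (A (P ⊗ (1 - V))) = 0`, so that `A (V ⊗ (1 - V)) = 0` and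
`A` splits along `V ⊗ V` and `(1 - V) ⊗ (1 - V)`. Weak irreducibility then gives `V γ i V = γ i` for
all `i`: up to its sign `γ₁` is positive semidefinite, and every `γ i` lives on its range.

Over that range, `γ₁ ⊗ γ₁ - μ • (V ⊗ V)` and `γ i ⊗ γ i + (1 / 2) • (V ⊗ V)` are diagonal in a
product basis with nonnegative eigenvalues, the second because `|a b| ≤ (a² + b²) / 2 ≤ 1 / 2` for
distinct eigenvalues `a`, `b` of `γ i`. Such matrices are separable, and `A` is a combination of
them and of `V ⊗ V` with nonnegative coefficients.

For the Pauli basis, testing positivity of `A` on antisymmetric vectors gives `tr (A F) ≤ tr A`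
with `F` the flip operator, which reads `λ₁ + λ₂ + λ₃ + λ₄ ≤ 2 λ₁`.
-/

namespace Bipartite

open Matrix

section Separable

variable {k m : ℕ} {A B : TMat k m}

lemma IsSeparable.zero : IsSeparable (0 : TMat k m) :=
  ⟨0, fun _ => 0, fun _ => 0, fun i => i.elim0, fun i => i.elim0, by simp⟩

lemma IsSeparable.kronecker {C : Matrix (Fin k) (Fin k) ℂ} {D : Matrix (Fin m) (Fin m) ℂ}
    (hC : C.PosSemidef) (hD : D.PosSemidef) : IsSeparable (C ⊗ₖ D) :=
  ⟨1, fun _ => C, fun _ => D, fun _ => hC, fun _ => hD, by simp⟩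

lemma IsSeparable.add (hA : IsSeparable A) (hB : IsSeparable B) : IsSeparable (A + B) := by
  obtain ⟨n, C, D, hC, hD, rfl⟩ := hA
  obtain ⟨n', C', D', hC', hD', rfl⟩ := hB
  refine ⟨n + n', Fin.append C C', Fin.append D D', fun i => ?_, fun i => ?_, ?_⟩
  · induction i using Fin.addCases <;> simp [hC, hC']
  · induction i using Fin.addCases <;> simp [hD, hD']
  · simp [Fin.sum_univ_add]

lemma IsSeparable.sum {ι : Type*} (s : Finset ι) {A : ι → TMat k m}
    (hA : ∀ i ∈ s, IsSeparable (A i)) : IsSeparable (∑ i ∈ s, A i) :=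
  Finset.sum_induction A IsSeparable (fun _ _ => IsSeparable.add) IsSeparable.zero hA

lemma IsSeparable.smul (hA : IsSeparable A) {r : ℝ} (hr : 0 ≤ r) : IsSeparable (r • A) := by
  obtain ⟨n, C, D, hC, hD, rfl⟩ := hA
  refine ⟨n, fun i => r • C i, D, fun i => (hC i).smul hr, hD, ?_⟩
  simp only [Finset.smul_sum, smul_kronecker]

lemma IsSeparable.conj_kronecker (hA : IsSeparable A) (V : Matrix (Fin k) (Fin k) ℂ)
    (W : Matrix (Fin m) (Fin m) ℂ) : IsSeparable ((V ⊗ₖ W) * A * (Vᴴ ⊗ₖ Wᴴ)) := by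
  obtain ⟨n, C, D, hC, hD, rfl⟩ := hA
  refine ⟨n, fun i => V * C i * Vᴴ, fun i => W * D i * Wᴴ,
    fun i => (hC i).mul_mul_conjTranspose_same V, fun i => (hD i).mul_mul_conjTranspose_same W, ?_⟩
  simp only [Finset.mul_sum, Finset.sum_mul, mul_kronecker_mul]

lemma IsSeparable.posSemidef (hA : IsSeparable A) : A.PosSemidef := by
  obtain ⟨n, C, D, hC, hD, rfl⟩ := hA
  exact posSemidef_sum _ fun i _ => (hC i).kronecker (hD i)

end Separable

section DiagonalIn

variable {ι κ 𝕜 : Type*} [Fintype ι] [DecidableEq ι] [Fintype κ] [DecidableEq κ] [RCLike 𝕜]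

/-- The Hermitian matrices that are diagonal in the orthonormal basis formed by the columns of `U`:
`diagonalIn U f` has eigenvalue `f i` on the `i`-th column. It is bundled as a star algebra
homomorphism so that identities between such matrices can be checked pointwise on eigenvalues. -/
noncomputable def diagonalIn (U : unitaryGroup ι 𝕜) : (ι → ℝ) →⋆ₐ[ℝ] Matrix ι ι 𝕜 where
  toAlgHom := (Unitary.conjStarAlgAut ℝ (Matrix ι ι 𝕜) U).toAlgEquiv.toAlgHom.comp
    ((diagonalAlgHom ℝ).comp (RCLike.ofRealAm.compLeft ι))
  map_star' f := by
    change Unitary.conjStarAlgAut ℝ _ U (diagonal _) =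
      star (Unitary.conjStarAlgAut ℝ _ U (diagonal _))
    rw [← map_star, star_eq_conjTranspose, diagonal_conjTranspose]
    congr 2
    ext i
    simp

variable (U : unitaryGroup ι 𝕜) (W : unitaryGroup κ 𝕜)

lemma diagonalIn_apply (f : ι → ℝ) :
    diagonalIn U f = (U : Matrix ι ι 𝕜) * diagonal (fun i => (f i : 𝕜)) * (U : Matrix ι ι 𝕜)ᴴ :=
  rfl

lemma exists_eq_diagonalIn {X : Matrix ι ι 𝕜} (hX : X.IsHermitian) :
    ∃ (U : unitaryGroup ι 𝕜) (a : ι → ℝ), X = diagonalIn U a :=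
  ⟨hX.eigenvectorUnitary, hX.eigenvalues, hX.spectral_theorem⟩

lemma posSemidef_diagonalIn_iff {f : ι → ℝ} : (diagonalIn U f).PosSemidef ↔ 0 ≤ f := by
  rw [diagonalIn_apply, ← star_eq_conjTranspose,
    Unitary.isUnit_coe.posSemidef_star_right_conjugate_iff, posSemidef_diagonal_iff, Pi.le_def]
  simp only [RCLike.ofReal_nonneg, Pi.zero_apply]

lemma trace_diagonalIn (f : ι → ℝ) : (diagonalIn U f).trace = ∑ i, (f i : 𝕜) := by
  rw [diagonalIn_apply, trace_mul_cycle, ← star_eq_conjTranspose, UnitaryGroup.star_mul_self,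
    Matrix.one_mul, trace_diagonal]

lemma diagonalIn_eq_sum (f : ι → ℝ) :
    diagonalIn U f = ∑ i, f i • diagonalIn U (Pi.single i 1) := by
  conv_lhs => rw [pi_eq_sum_univ' f]
  simp only [map_sum, map_smul]

lemma spectrum_diagonalIn (f : ι → ℝ) :
    spectrum 𝕜 (diagonalIn U f) = Set.range fun i => (f i : 𝕜) :=
  (Unitary.spectrum_star_right_conjugate (U := U)).trans (spectrum_diagonal _)

/-- The tensor product of two orthonormal bases, as a unitary matrix. -/
def unitaryKronecker : unitaryGroup (ι × κ) 𝕜 :=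
  ⟨(U : Matrix ι ι 𝕜) ⊗ₖ (W : Matrix κ κ 𝕜), kronecker_mem_unitary U.2 W.2⟩

lemma diagonalIn_kronecker_diagonalIn (f : ι → ℝ) (g : κ → ℝ) :
    diagonalIn U f ⊗ₖ diagonalIn W g =
      diagonalIn (unitaryKronecker U W) fun p => f p.1 * g p.2 := by
  simp only [diagonalIn_apply, unitaryKronecker, conjTranspose_kronecker, mul_kronecker_mul,
    diagonal_kronecker_diagonal, RCLike.ofReal_mul]

end DiagonalIn

lemma isSeparable_diagonalIn_unitaryKronecker {k m : ℕ} (U : unitaryGroup (Fin k) ℂ)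
    (W : unitaryGroup (Fin m) ℂ) {f : Fin k × Fin m → ℝ} (hf : 0 ≤ f) :
    IsSeparable (diagonalIn (unitaryKronecker U W) f) := by
  have single_eq (p : Fin k × Fin m) : diagonalIn (unitaryKronecker U W) (Pi.single p 1) =
      diagonalIn U (Pi.single p.1 1) ⊗ₖ diagonalIn W (Pi.single p.2 1) := by
    rw [diagonalIn_kronecker_diagonalIn]
    congr 1
    ext q
    by_cases h : q.1 = p.1 <;> simp [Pi.single_apply, Prod.ext_iff, h]
  rw [diagonalIn_eq_sum]
  refine IsSeparable.sum _ fun p _ => IsSeparable.smul ?_ (hf p)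
  rw [single_eq]
  exact .kronecker ((posSemidef_diagonalIn_iff U).2 (by simp))
    ((posSemidef_diagonalIn_iff W).2 (by simp))

lemma isSeparable_kronecker_self_add_trace_mul_self {k : ℕ} {γ : Matrix (Fin k) (Fin k) ℂ}
    (hγ : γ.IsHermitian) : IsSeparable (γ ⊗ₖ γ + ((γ * γ).trace / 2) • 1) := by
  obtain ⟨U, a, rfl⟩ := exists_eq_diagonalIn hγ
  have eq : diagonalIn U a ⊗ₖ diagonalIn U a + ((diagonalIn U a * diagonalIn U a).trace / 2) • 1 =
      diagonalIn (unitaryKronecker U U)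
        ((fun p => a p.1 * a p.2) + ((∑ i, a i * a i) / 2) • 1) := by
    rw [map_add, map_smul, map_one, diagonalIn_kronecker_diagonalIn, ← map_mul, trace_diagonalIn,
      ← Complex.coe_smul]
    simp
  rw [eq]
  refine isSeparable_diagonalIn_unitaryKronecker U U fun ⟨i, j⟩ => ?_
  suffices 0 ≤ a i * a j + (∑ l, a l * a l) / 2 by simpa
  by_cases hij : i = j
  · subst hij
    have := Finset.sum_nonneg fun l (_ : l ∈ Finset.univ) => mul_self_nonneg (a l)
    nlinarith [mul_self_nonneg (a i)]
  · have := Finset.add_le_sum (f := fun l => a l * a l) (s := Finset.univ)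
      (fun l _ => mul_self_nonneg (a l)) (Finset.mem_univ i) (Finset.mem_univ j) hij
    nlinarith [mul_self_nonneg (a i + a j)]

section RangeProjection

/-- `V` is the range projection of `X`: the Hermitian projection onto the range of `X`. The third
field says that the range of `V` is contained in that of `X`, and it is what turns `Z * X = 0` into
`Z * V = 0`. -/
structure IsRangeProjection {R : Type*} [Semigroup R] [Star R] (V X : R) : Prop where
  isStarProjection : IsStarProjection V
  mul_eq : V * X = X
  exists_eq_mul : ∃ Y, V = X * Y

lemma IsRangeProjection.unique {R : Type*} [Semigroup R] [StarMul R] {V V' X : R}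
    (hV : IsRangeProjection V X) (hV' : IsRangeProjection V' X) : V = V' := by
  obtain ⟨Y, hY⟩ := hV.exists_eq_mul
  obtain ⟨Y', hY'⟩ := hV'.exists_eq_mul
  calc V = V' * V := by rw [hY, ← mul_assoc, hV'.mul_eq]
    _ = star (V * V') := by
      rw [star_mul, hV.isStarProjection.isSelfAdjoint, hV'.isStarProjection.isSelfAdjoint]
    _ = V' := by
      rw [hY', ← mul_assoc, hV.mul_eq, ← hY', hV'.isStarProjection.isSelfAdjoint]

lemma IsRangeProjection.neg {R : Type*} [Ring R] [StarRing R] {V X : R}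
    (hV : IsRangeProjection V X) : IsRangeProjection V (-X) where
  isStarProjection := hV.isStarProjection
  mul_eq := by rw [mul_neg, hV.mul_eq]
  exists_eq_mul := by
    obtain ⟨Y, hY⟩ := hV.exists_eq_mul
    exact ⟨-Y, by rw [neg_mul_neg, hY]⟩

variable {ι 𝕜 : Type*} [Fintype ι] [RCLike 𝕜]

-- Since `0⁻¹ = 0`, the function `a * a⁻¹` is the indicator of the support of `a`.
lemma isRangeProjection_diagonalIn [DecidableEq ι] (U : unitaryGroup ι 𝕜) (a : ι → ℝ) :
    IsRangeProjection (diagonalIn U (a * a⁻¹)) (diagonalIn U a) where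
  isStarProjection := by
    refine IsStarProjection.map ⟨?_, IsSelfAdjoint.all _⟩ (diagonalIn U)
    ext i
    simp [← mul_assoc]
  mul_eq := by
    rw [← map_mul]
    congr 1
    ext i
    simp
  exists_eq_mul := ⟨diagonalIn U a⁻¹, map_mul _ _ _⟩

lemma exists_isRangeProjection {X : Matrix ι ι 𝕜} (hX : X.IsHermitian) :
    ∃ V, IsRangeProjection V X := by
  classical
  obtain ⟨U, a, rfl⟩ := exists_eq_diagonalIn hX
  exact ⟨_, isRangeProjection_diagonalIn U a⟩

end RangeProjection

section PosSemidef

variable {ι 𝕜 : Type*} [Fintype ι] [RCLike 𝕜] {X Y : Matrix ι ι 𝕜}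

lemma exists_posSemidef_sub_posSemidef (hX : X.IsHermitian) :
    ∃ P N : Matrix ι ι 𝕜, P.PosSemidef ∧ N.PosSemidef ∧ P * N = 0 ∧ X = P - N := by
  classical
  obtain ⟨U, a, rfl⟩ := exists_eq_diagonalIn hX
  refine ⟨diagonalIn U a⁺, diagonalIn U a⁻, (posSemidef_diagonalIn_iff U).2 (posPart_nonneg a),
    (posSemidef_diagonalIn_iff U).2 (negPart_nonneg a), ?_, ?_⟩
  · rw [← map_mul, ← map_zero (diagonalIn U)]
    congr 1
    ext i
    rcases le_total 0 (a i) with hi | hi <;> simp [hi]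
  · rw [← map_sub, posPart_sub_negPart]

lemma exists_eq_conjTranspose_mul_self (hX : X.PosSemidef) : ∃ S : Matrix ι ι 𝕜, X = Sᴴ * S := by
  classical
  open scoped MatrixOrder in
  exact CStarAlgebra.nonneg_iff_eq_star_mul_self.1 hX.nonneg

lemma posSemidef_of_isStarProjection (hX : IsStarProjection X) : X.PosSemidef := by
  classical
  open scoped MatrixOrder in
  exact nonneg_iff_posSemidef.1 hX.nonneg

lemma trace_conjTranspose_mul_self_mul (S Y : Matrix ι ι 𝕜) :
    (Sᴴ * S * Y).trace = (S * Y * Sᴴ).trace := by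
  rw [Matrix.mul_assoc, trace_mul_comm]

lemma trace_mul_nonneg (hX : X.PosSemidef) (hY : Y.PosSemidef) : 0 ≤ (X * Y).trace := by
  obtain ⟨S, rfl⟩ := exists_eq_conjTranspose_mul_self hX
  rw [trace_conjTranspose_mul_self_mul]
  exact (hY.mul_mul_conjTranspose_same S).trace_nonneg

lemma mul_eq_zero_of_trace_mul_eq_zero (hX : X.PosSemidef) (hY : Y.PosSemidef)
    (h : (X * Y).trace = 0) : X * Y = 0 := by
  obtain ⟨S, rfl⟩ := exists_eq_conjTranspose_mul_self hX
  obtain ⟨R, rfl⟩ := exists_eq_conjTranspose_mul_self hY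
  have hSR : S * Rᴴ = 0 := by
    rw [← trace_mul_conjTranspose_self_eq_zero_iff, ← h, trace_conjTranspose_mul_self_mul,
      conjTranspose_mul, conjTranspose_conjTranspose]
    simp only [Matrix.mul_assoc]
  rw [Matrix.mul_assoc, ← Matrix.mul_assoc S, hSR, Matrix.zero_mul, Matrix.mul_zero]

lemma trace_mul_eq_ofReal_re (hX : X.IsHermitian) (hY : Y.IsHermitian) :
    (X * Y).trace = RCLike.re (X * Y).trace := by
  refine (RCLike.conj_eq_iff_re.1 ?_).symm
  rw [starRingEnd_apply, ← trace_conjTranspose, conjTranspose_mul, hX, hY, trace_mul_comm]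

end PosSemidef

section FlipTrace

variable {ι R : Type*} [Fintype ι]

/-- The linear functional `A ↦ tr (A F)`, where `F` is the flip operator `x ⊗ y ↦ y ⊗ x`. It sends
`X ⊗ Y` to `tr (X Y)`. -/
def flipTrace [CommSemiring R] : Matrix (ι × ι) (ι × ι) R →ₗ[R] R where
  toFun A := ∑ p, A p p.swap
  map_add' _ _ := Finset.sum_add_distrib
  map_smul' _ _ := (Finset.mul_sum ..).symm

lemma flipTrace_kronecker [CommSemiring R] (X Y : Matrix ι ι R) :
    flipTrace (X ⊗ₖ Y) = (X * Y).trace :=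
  Fintype.sum_prod_type _

-- The quadratic form of `A` is nonnegative on the antisymmetric vectors `e_p - e_{p.swap}`.
lemma flipTrace_le_trace {𝕜 : Type*} [RCLike 𝕜] {A : Matrix (ι × ι) (ι × ι) 𝕜}
    (hA : A.PosSemidef) : flipTrace A ≤ A.trace := by
  have antisymm (p : ι × ι) : 0 ≤ (A p p - A p p.swap) + (A p.swap p.swap - A p.swap p) := by
    have := (hA.submatrix ![p, p.swap]).dotProduct_mulVec_nonneg ![1, -1]
    simp only [dotProduct, mulVec, Fin.sum_univ_two, submatrix_apply, Pi.star_apply, cons_val_zero,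
      cons_val_one, star_one, star_neg] at this
    linear_combination this
  have sum_swap : ∑ p, (A p.swap p.swap - A p.swap p) = ∑ p, (A p p - A p p.swap) :=
    (Equiv.prodComm ι ι).sum_comp fun p => A p p - A p p.swap
  refine le_of_mul_le_mul_left (sub_nonneg.1 ?_) (two_pos : (0 : 𝕜) < 2)
  calc
    0 ≤ ∑ p, ((A p p - A p p.swap) + (A p.swap p.swap - A p.swap p)) :=
      Finset.sum_nonneg fun p _ => antisymm p
    _ = 2 * ∑ p, (A p p - A p p.swap) := by rw [Finset.sum_add_distrib, sum_swap, two_mul]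
    _ = 2 * A.trace - 2 * flipTrace A := by rw [Finset.sum_sub_distrib, mul_sub]; rfl

end FlipTrace

lemma eq_zero_of_sum_smul_conjTranspose_kronecker_eq_zero {ι κ 𝕜 : Type*} [Finite ι] [Fintype κ]
    [RCLike 𝕜] {c : κ → ℝ} (hc : ∀ i, 0 < c i) {B : κ → Matrix ι ι 𝕜}
    (h : ∑ i, c i • ((B i)ᴴ ⊗ₖ B i) = 0) (i : κ) : B i = 0 := by
  have := Fintype.ofFinite ι
  have hsum : ∑ i, c i • ((B i)ᴴ * B i).trace = 0 := by
    simpa only [map_sum, LinearMap.map_smul_of_tower, flipTrace_kronecker, map_zero] using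
      congrArg flipTrace h
  have hi := (Finset.sum_eq_zero_iff_of_nonneg fun i _ => smul_nonneg (hc i).le
    (posSemidef_conjTranspose_mul_self (B i)).trace_nonneg).1 hsum i (Finset.mem_univ i)
  exact trace_conjTranspose_mul_self_eq_zero_iff.1 ((smul_eq_zero.1 hi).resolve_left (hc i).ne')

section Schmidt

variable {k n : ℕ} {A : TMat k k} {c : Fin n → ℝ} {γ : Fin n → Matrix (Fin k) (Fin k) ℂ}

/-- The map `X ↦ ∑ i, c i • tr (γ i X) • γ i`. If `A = ∑ i, c i • (γ i ⊗ γ i)`, this is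
`X ↦ tr₁ (A (X ⊗ 1))`, where `tr₁` is the partial trace over the first factor, and the Schmidt
decomposition of `A` is its spectral decomposition. -/
noncomputable def schmidtMap (c : Fin n → ℝ) (γ : Fin n → Matrix (Fin k) (Fin k) ℂ) :
    Matrix (Fin k) (Fin k) ℂ →ₗ[ℂ] Matrix (Fin k) (Fin k) ℂ :=
  ∑ i, c i • (traceLinearMap _ ℂ ℂ ∘ₗ LinearMap.mulLeft ℂ (γ i)).smulRight (γ i)

lemma schmidtMap_apply (X : Matrix (Fin k) (Fin k) ℂ) :
    schmidtMap c γ X = ∑ i, c i • (γ i * X).trace • γ i := by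
  simp [schmidtMap]

lemma trace_schmidtMap_mul (X Y : Matrix (Fin k) (Fin k) ℂ) :
    (schmidtMap c γ X * Y).trace = ∑ i, c i • ((γ i * X).trace * (γ i * Y).trace) := by
  simp only [schmidtMap_apply, Finset.sum_mul, trace_sum, smul_mul_assoc, trace_smul, smul_eq_mul]

namespace IsHermitianSchmidt

variable (h : IsHermitianSchmidt A c γ γ)
include h

lemma eq_sum_real_smul : A = ∑ i, c i • (γ i ⊗ₖ γ i) := by
  simpa only [Complex.coe_smul] using h.eq_sum

lemma kronecker_mul_mul_kronecker (X Y Z W : Matrix (Fin k) (Fin k) ℂ) :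
    (X ⊗ₖ Y) * A * (Z ⊗ₖ W) = ∑ i, c i • ((X * γ i * Z) ⊗ₖ (Y * γ i * W)) := by
  simp only [h.eq_sum_real_smul, Finset.mul_sum, Finset.sum_mul, mul_smul_comm, smul_mul_assoc,
    mul_kronecker_mul]

lemma trace_mul_kronecker (X Y : Matrix (Fin k) (Fin k) ℂ) :
    (A * (X ⊗ₖ Y)).trace = (schmidtMap c γ X * Y).trace := by
  simp only [h.eq_sum_real_smul, Finset.sum_mul, smul_mul_assoc, ← mul_kronecker_mul, trace_sum,
    trace_smul, trace_kronecker, trace_schmidtMap_mul]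

lemma trace_mul (i j : Fin n) : (γ i * γ j).trace = if i = j then 1 else 0 := by
  simpa only [(h.left_hermitian j).eq] using h.left_orthonormal i j

lemma schmidtMap_self (i : Fin n) : schmidtMap c γ (γ i) = c i • γ i := by
  simp [schmidtMap_apply, h.trace_mul]

lemma schmidtMap_isHermitian {X : Matrix (Fin k) (Fin k) ℂ} (hX : X.IsHermitian) :
    (schmidtMap c γ X).IsHermitian := by
  rw [IsHermitian, schmidtMap_apply, conjTranspose_sum]
  refine Finset.sum_congr rfl fun i _ => ?_
  rw [trace_mul_eq_ofReal_re (h.left_hermitian i) hX]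
  simp [conjTranspose_smul, (h.left_hermitian i).eq]

lemma trace_schmidtMap_mul_schmidtMap (X : Matrix (Fin k) (Fin k) ℂ) :
    (schmidtMap c γ X * schmidtMap c γ X).trace = ∑ i, c i ^ 2 • (γ i * X).trace ^ 2 := by
  rw [trace_schmidtMap_mul]
  refine Finset.sum_congr rfl fun i _ => ?_
  rw [trace_mul_comm (γ i) (schmidtMap c γ X), trace_schmidtMap_mul]
  simp [h.trace_mul, sq, mul_assoc, mul_left_comm]

-- The leading coefficient is the norm of the Hermitian map `schmidtMap c γ`, so a matrix on which
-- its quadratic form attains this norm is an eigenvector.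
lemma schmidtMap_eq_smul_of_le {i₀ : Fin n} (hc : ∀ i, c i ≤ c i₀) {X : Matrix (Fin k) (Fin k) ℂ}
    (hX : X.IsHermitian) (hle : c i₀ • (X * X).trace ≤ (schmidtMap c γ X * X).trace) :
    schmidtMap c γ X = c i₀ • X := by
  set m := c i₀
  set G := schmidtMap c γ X
  have hR : (G - m • X).IsHermitian :=
    (h.schmidtMap_isHermitian hX).sub (hX.smul (IsSelfAdjoint.all m))
  have sum_le : (G * G).trace ≤ m • (G * X).trace := by
    rw [h.trace_schmidtMap_mul_schmidtMap, trace_schmidtMap_mul, Finset.smul_sum]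
    refine Finset.sum_le_sum fun i _ => ?_
    have sq_nonneg : 0 ≤ (γ i * X).trace ^ 2 := by
      rw [trace_mul_eq_ofReal_re (h.left_hermitian i) hX, ← RCLike.ofReal_pow]
      exact RCLike.ofReal_nonneg.2 (_root_.sq_nonneg _)
    rw [← sq, sq (c i), smul_smul]
    exact smul_le_smul_of_nonneg_right (mul_le_mul_of_nonneg_right (hc i) (h.coeff_pos i).le)
      sq_nonneg
  have trace_le : ((G - m • X) * (G - m • X)).trace ≤ 0 := by
    calc ((G - m • X) * (G - m • X)).trace
        = ((G * G).trace - m • (G * X).trace) + m • (m • (X * X).trace - (G * X).trace) := by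
          simp only [sub_mul, mul_sub, mul_smul_comm, smul_mul_assoc, trace_sub, trace_smul,
            smul_sub, trace_mul_comm X G]
          abel
      _ ≤ 0 := add_nonpos (sub_nonpos.2 sum_le)
          (smul_nonpos_of_nonneg_of_nonpos (h.coeff_pos i₀).le (sub_nonpos.2 hle))
  rw [← sub_eq_zero, ← trace_conjTranspose_mul_self_eq_zero_iff]
  refine le_antisymm (by rwa [hR.eq]) (posSemidef_conjTranspose_mul_self _).trace_nonneg

lemma submatrix_swap : A.submatrix Prod.swap Prod.swap = A := by
  rw [h.eq_sum_real_smul]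
  ext p q
  simp [Matrix.sum_apply, mul_comm]

lemma mul_kronecker_swap_eq_zero {X Y : Matrix (Fin k) (Fin k) ℂ} (hXY : A * (X ⊗ₖ Y) = 0) :
    A * (Y ⊗ₖ X) = 0 := by
  have swap_kronecker : (X ⊗ₖ Y).submatrix Prod.swap Prod.swap = Y ⊗ₖ X := by
    ext p q
    simp [mul_comm]
  calc A * (Y ⊗ₖ X)
      = A.submatrix Prod.swap Prod.swap * (X ⊗ₖ Y).submatrix Prod.swap Prod.swap := by
        rw [h.submatrix_swap, swap_kronecker]
    _ = (A * (X ⊗ₖ Y)).submatrix Prod.swap Prod.swap :=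
        submatrix_mul_equiv A (X ⊗ₖ Y) _ (Equiv.prodComm _ _) _
    _ = 0 := by rw [hXY]; rfl

lemma mul_mul_eq_zero {X Y : Matrix (Fin k) (Fin k) ℂ}
    (hXY : (Xᴴ ⊗ₖ Y) * A * (Yᴴ ⊗ₖ X) = 0) (i : Fin n) : Y * γ i * X = 0 := by
  refine eq_zero_of_sum_smul_conjTranspose_kronecker_eq_zero (B := fun i => Y * γ i * X)
    h.coeff_pos ?_ i
  rw [← hXY, h.kronecker_mul_mul_kronecker]
  simp only [conjTranspose_mul, (h.left_hermitian _).eq, Matrix.mul_assoc]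

variable {P V : Matrix (Fin k) (Fin k) ℂ} {r : ℝ}

lemma mul_kronecker_one_sub_eq_zero (hA : A.PosSemidef) (hP : P.PosSemidef)
    (hGP : schmidtMap c γ P = r • P) (hV : IsRangeProjection V P) : A * (V ⊗ₖ (1 - V)) = 0 := by
  have hPV : P * (1 - V) = 0 := by
    have hVP : (1 - V) * P = 0 := by rw [sub_mul, one_mul, hV.mul_eq, sub_self]
    rw [← hVP]
    exact (hV.isStarProjection.one_sub.isSelfAdjoint.commute_of_mul_eq_zero
      hP.isHermitian.isSelfAdjoint hVP).eq.symm
  have hAP : A * (P ⊗ₖ (1 - V)) = 0 := by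
    refine mul_eq_zero_of_trace_mul_eq_zero hA
      (hP.kronecker (posSemidef_of_isStarProjection hV.isStarProjection.one_sub)) ?_
    rw [h.trace_mul_kronecker, hGP, smul_mul_assoc, hPV, smul_zero, trace_zero]
  obtain ⟨Y, hY⟩ := hV.exists_eq_mul
  calc A * (V ⊗ₖ (1 - V)) = A * (P ⊗ₖ (1 - V)) * (Y ⊗ₖ 1) := by
        rw [Matrix.mul_assoc, ← mul_kronecker_mul, ← hY, Matrix.mul_one]
    _ = 0 := by rw [hAP, Matrix.zero_mul]

lemma eq_add_of_mul_kronecker_one_sub_eq_zero (hV : IsStarProjection V)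
    (hAV : A * (V ⊗ₖ (1 - V)) = 0) (i : Fin n) :
    γ i = V * γ i * V + (1 - V) * γ i * (1 - V) := by
  have hVW : V * γ i * (1 - V) = 0 := by
    refine h.mul_mul_eq_zero ?_ i
    rw [show Vᴴ = V from hV.isSelfAdjoint, Matrix.mul_assoc, hAV, Matrix.mul_zero]
  have hWV : (1 - V) * γ i * V = 0 := by
    refine h.mul_mul_eq_zero ?_ i
    rw [show (1 - V)ᴴ = 1 - V from hV.one_sub.isSelfAdjoint, Matrix.mul_assoc,
      h.mul_kronecker_swap_eq_zero hAV, Matrix.mul_zero]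
  calc γ i = (V + (1 - V)) * γ i * (V + (1 - V)) := by simp
    _ = V * γ i * V + (1 - V) * γ i * (1 - V) := by
      rw [add_mul, add_mul, mul_add, mul_add, hVW, hWV, add_zero, zero_add]

lemma eq_add_conj_of_mul_kronecker_one_sub_eq_zero (hV : IsStarProjection V)
    (hAV : A * (V ⊗ₖ (1 - V)) = 0) :
    A = (V ⊗ₖ V) * A * (V ⊗ₖ V) + ((1 - V) ⊗ₖ (1 - V)) * A * ((1 - V) ⊗ₖ (1 - V)) := by
  have hVW : (V ⊗ₖ (1 - V)) * A * (V ⊗ₖ (1 - V)) = 0 := by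
    rw [Matrix.mul_assoc, hAV, Matrix.mul_zero]
  have hWV : ((1 - V) ⊗ₖ V) * A * ((1 - V) ⊗ₖ V) = 0 := by
    rw [Matrix.mul_assoc, h.mul_kronecker_swap_eq_zero hAV, Matrix.mul_zero]
  calc A = ∑ i, c i • (γ i ⊗ₖ γ i) := h.eq_sum_real_smul
    _ = ∑ i, c i • ((V * γ i * V + (1 - V) * γ i * (1 - V)) ⊗ₖ
        (V * γ i * V + (1 - V) * γ i * (1 - V))) := by
      simp only [← h.eq_add_of_mul_kronecker_one_sub_eq_zero hV hAV]
    _ = (V ⊗ₖ V) * A * (V ⊗ₖ V) + (V ⊗ₖ (1 - V)) * A * (V ⊗ₖ (1 - V)) +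
        (((1 - V) ⊗ₖ V) * A * ((1 - V) ⊗ₖ V) +
          ((1 - V) ⊗ₖ (1 - V)) * A * ((1 - V) ⊗ₖ (1 - V))) := by
      simp only [h.kronecker_mul_mul_kronecker, ← Finset.sum_add_distrib, ← smul_add,
        ← kronecker_add, ← add_kronecker]
    _ = _ := by rw [hVW, hWV, add_zero, zero_add]

lemma mul_mul_eq_self_of_isWeakIrreducible (hA : IsWeakIrreducible A) (hP : P.PosSemidef)
    (hP0 : P ≠ 0) (hr : r ≠ 0) (hGP : schmidtMap c γ P = r • P) (hV : IsRangeProjection V P)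
    (i : Fin n) : V * γ i * V = γ i := by
  have hproj := hV.isStarProjection
  have hAV := h.mul_kronecker_one_sub_eq_zero hA.1 hP hGP hV
  have hsplit := h.eq_add_of_mul_kronecker_one_sub_eq_zero hproj hAV
  have hVW : V * (1 - V) = 0 := by rw [mul_sub, mul_one, hproj.isIdempotentElem, sub_self]
  rcases hA.2 V (1 - V) V (1 - V) hproj hproj.one_sub hproj hproj.one_sub hVW hVW
    (add_sub_cancel V 1) (add_sub_cancel V 1)
    (h.eq_add_conj_of_mul_kronecker_one_sub_eq_zero hproj hAV) with hzero | hzero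
  · have hVγV (j : Fin n) : V * γ j * V = 0 := by
      refine h.mul_mul_eq_zero ?_ j
      rwa [show Vᴴ = V from hproj.isSelfAdjoint]
    have trace_eq_zero (j : Fin n) : (γ j * P).trace = 0 := by
      have hWP : (1 - V) * P = 0 := by rw [sub_mul, one_mul, hV.mul_eq, sub_self]
      rw [hsplit j, hVγV j, zero_add, Matrix.mul_assoc, hWP, Matrix.mul_zero, trace_zero]
    have hGP0 : schmidtMap c γ P = 0 := by simp [schmidtMap_apply, trace_eq_zero]
    exact absurd ((smul_eq_zero.1 (hGP.symm.trans hGP0)).resolve_left hr) hP0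
  · have hWγW : (1 - V) * γ i * (1 - V) = 0 := by
      refine h.mul_mul_eq_zero ?_ i
      rwa [show (1 - V)ᴴ = 1 - V from hproj.one_sub.isSelfAdjoint]
    simpa only [hWγW, add_zero] using (hsplit i).symm

lemma schmidtMap_eq_smul_of_eq_sub (hA : A.PosSemidef) {i₀ : Fin n} (hc : ∀ i, c i ≤ c i₀)
    {P N : Matrix (Fin k) (Fin k) ℂ} (hP : P.PosSemidef) (hN : N.PosSemidef) (hPN : P * N = 0)
    (hsub : γ i₀ = P - N) : schmidtMap c γ P = c i₀ • P := by
  set G := schmidtMap c γ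
  have hNP : N * P = 0 := (hP.isHermitian.isSelfAdjoint.commute_of_mul_eq_zero
    hN.isHermitian.isSelfAdjoint hPN).eq.symm.trans hPN
  have hGsub : G (P - N) = c i₀ • (P - N) := hsub ▸ h.schmidtMap_self i₀
  have cross_nonneg {X Y : Matrix (Fin k) (Fin k) ℂ} (hX : X.PosSemidef) (hY : Y.PosSemidef) :
      0 ≤ (G X * Y).trace := by
    rw [← h.trace_mul_kronecker]
    exact trace_mul_nonneg hA (hX.kronecker hY)
  have hGadd : G (P + N) = c i₀ • (P + N) := by
    refine h.schmidtMap_eq_smul_of_le hc (hP.add hN).isHermitian ?_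
    calc c i₀ • ((P + N) * (P + N)).trace
        = c i₀ • ((P - N) * (P - N)).trace := by
          simp only [add_mul, mul_add, sub_mul, mul_sub, hPN, hNP, sub_zero, zero_sub, add_zero,
            zero_add, sub_neg_eq_add]
      _ = (G (P - N) * (P - N)).trace := by rw [hGsub, smul_mul_assoc, trace_smul]
      _ ≤ (G (P - N) * (P - N)).trace + (2 * (G P * N).trace + 2 * (G N * P).trace) :=
          le_add_of_nonneg_right (add_nonneg (mul_nonneg zero_le_two (cross_nonneg hP hN))
            (mul_nonneg zero_le_two (cross_nonneg hN hP)))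
      _ = (G (P + N) * (P + N)).trace := by
          simp only [map_add, map_sub, add_mul, mul_add, sub_mul, mul_sub, trace_add, trace_sub]
          ring
  have two_smul_eq : (2 : ℝ) • G P = (2 : ℝ) • c i₀ • P := by
    calc (2 : ℝ) • G P = G (P + N) + G (P - N) := by rw [map_add, map_sub]; module
      _ = (2 : ℝ) • c i₀ • P := by rw [hGadd, hGsub]; module
  exact smul_right_injective _ (two_ne_zero' ℝ) two_smul_eq

lemma left_ne_zero (i : Fin n) : γ i ≠ 0 := by
  intro hi
  simpa [hi] using h.trace_mul i i

lemma posSemidef_or_neg_posSemidef (hA : IsWeakIrreducible A) {i₀ : Fin n}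
    (hc : ∀ i, c i ≤ c i₀) : (γ i₀).PosSemidef ∨ (-γ i₀).PosSemidef := by
  obtain ⟨P, N, hP, hN, hPN, hsub⟩ := exists_posSemidef_sub_posSemidef (h.left_hermitian i₀)
  rcases eq_or_ne P 0 with rfl | hP0
  · right
    rwa [hsub, zero_sub, neg_neg]
  left
  obtain ⟨V, hV⟩ := exists_isRangeProjection hP.isHermitian
  have hVγV : V * γ i₀ * V = γ i₀ := h.mul_mul_eq_self_of_isWeakIrreducible hA hP hP0
    (h.coeff_pos i₀).ne' (h.schmidtMap_eq_smul_of_eq_sub hA.1 hc hP hN hPN hsub) hV i₀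
  have hNV : N * V = 0 := by
    obtain ⟨Y, hY⟩ := hV.exists_eq_mul
    have hNP : N * P = 0 := (hP.isHermitian.isSelfAdjoint.commute_of_mul_eq_zero
      hN.isHermitian.isSelfAdjoint hPN).eq.symm.trans hPN
    rw [hY, ← Matrix.mul_assoc, hNP, Matrix.zero_mul]
  have conj_eq : V * γ i₀ * V = Vᴴ * P * V := by
    rw [hsub, Matrix.mul_assoc, sub_mul, hNV, sub_zero, ← Matrix.mul_assoc,
      show Vᴴ = V from hV.isStarProjection.isSelfAdjoint]
  rw [← hVγV, conj_eq]
  exact hP.conjTranspose_mul_mul_same V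

lemma exists_posSemidef_isRangeProjection (hA : IsWeakIrreducible A) {i₀ : Fin n}
    (hc : ∀ i, c i ≤ c i₀) : ∃ P V : Matrix (Fin k) (Fin k) ℂ, P.PosSemidef ∧
      IsRangeProjection V P ∧ γ i₀ ⊗ₖ γ i₀ = P ⊗ₖ P ∧ ∀ i, V * γ i * V = γ i := by
  obtain ⟨V, hV⟩ := exists_isRangeProjection (h.left_hermitian i₀)
  rcases h.posSemidef_or_neg_posSemidef hA hc with hpos | hneg
  · exact ⟨γ i₀, V, hpos, hV, rfl, h.mul_mul_eq_self_of_isWeakIrreducible hA hpos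
      (h.left_ne_zero i₀) (h.coeff_pos i₀).ne' (h.schmidtMap_self i₀) hV⟩
  · refine ⟨-γ i₀, V, hneg, hV.neg, ?_, h.mul_mul_eq_self_of_isWeakIrreducible hA hneg
      (neg_ne_zero.2 (h.left_ne_zero i₀)) (h.coeff_pos i₀).ne' ?_ hV.neg⟩
    · ext
      simp
    · rw [map_neg, h.schmidtMap_self, smul_neg]

end IsHermitianSchmidt

end Schmidt

section Criterion

variable {k n : ℕ}

lemma isSeparable_kronecker_self_sub_smul {P V : Matrix (Fin k) (Fin k) ℂ} {μ : ℝ}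
    (hP : P.PosSemidef) (hV : IsRangeProjection V P) (hμ : IsLeastPosEigenvalue (P ⊗ₖ P) μ) :
    IsSeparable (P ⊗ₖ P - μ • (V ⊗ₖ V)) := by
  obtain ⟨U, a, rfl⟩ := exists_eq_diagonalIn hP.isHermitian
  obtain rfl := hV.unique (isRangeProjection_diagonalIn U a)
  have ha : 0 ≤ a := (posSemidef_diagonalIn_iff U).1 hP
  have le_mul (i j : Fin k) (hij : 0 < a i * a j) : μ ≤ a i * a j := by
    refine hμ.2 ⟨hij, ?_⟩
    rw [Module.End.hasEigenvalue_iff_mem_spectrum, spectrum_toLin',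
      diagonalIn_kronecker_diagonalIn, spectrum_diagonalIn]
    exact ⟨(i, j), rfl⟩
  rw [diagonalIn_kronecker_diagonalIn, diagonalIn_kronecker_diagonalIn, ← map_smul, ← map_sub]
  refine isSeparable_diagonalIn_unitaryKronecker U U fun ⟨i, j⟩ => ?_
  suffices μ * (a i * (a i)⁻¹ * (a j * (a j)⁻¹)) ≤ a i * a j by simpa
  rcases eq_or_ne (a i * a j) 0 with hij | hij
  · rcases mul_eq_zero.1 hij with hi | hj <;> simp [*]
  · obtain ⟨hi, hj⟩ := mul_ne_zero_iff.1 hij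
    rw [mul_inv_cancel₀ hi, mul_inv_cancel₀ hj, mul_one, mul_one]
    exact le_mul i j (lt_of_le_of_ne (mul_nonneg (ha i) (ha j)) hij.symm)

lemma isSeparable_kronecker_self_add_smul {γ V : Matrix (Fin k) (Fin k) ℂ} (hγ : γ.IsHermitian)
    (hV : IsStarProjection V) (hVγV : V * γ * V = γ) :
    IsSeparable (γ ⊗ₖ γ + ((γ * γ).trace / 2) • (V ⊗ₖ V)) := by
  have conj := (isSeparable_kronecker_self_add_trace_mul_self hγ).conj_kronecker V V
  rwa [show Vᴴ = V from hV.isSelfAdjoint, mul_add, add_mul, ← mul_kronecker_mul,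
    ← mul_kronecker_mul, hVγV, mul_smul_comm, Matrix.mul_one, smul_mul_assoc, ← mul_kronecker_mul,
    hV.isIdempotentElem] at conj

lemma IsHermitianSchmidt.isSeparable_of_leading {A : TMat k k} {c : Fin (n + 1) → ℝ}
    {γ : Fin (n + 1) → Matrix (Fin k) (Fin k) ℂ} (h : IsHermitianSchmidt A c γ γ)
    {V : Matrix (Fin k) (Fin k) ℂ} {μ : ℝ} (hV : IsStarProjection V)
    (hVγV : ∀ i : Fin n, V * γ i.succ * V = γ i.succ)
    (hγ₀ : IsSeparable (γ 0 ⊗ₖ γ 0 - μ • (V ⊗ₖ V))) (hle : (∑ i : Fin n, c i.succ) / 2 ≤ c 0 * μ) :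
    IsSeparable A := by
  have eq_sum : A = c 0 • (γ 0 ⊗ₖ γ 0 - μ • (V ⊗ₖ V)) +
      ∑ i : Fin n, c i.succ • (γ i.succ ⊗ₖ γ i.succ + (1 / 2 : ℝ) • (V ⊗ₖ V)) +
      (c 0 * μ - (∑ i : Fin n, c i.succ) / 2) • (V ⊗ₖ V) := by
    rw [h.eq_sum_real_smul, Fin.sum_univ_succ]
    simp only [smul_add, Finset.sum_add_distrib, ← Finset.sum_smul]
    module
  have hVV : IsSeparable (V ⊗ₖ V) :=
    .kronecker (posSemidef_of_isStarProjection hV) (posSemidef_of_isStarProjection hV)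
  rw [eq_sum]
  refine ((hγ₀.smul (h.coeff_pos 0).le).add (.sum _ fun i _ => .smul ?_ (h.coeff_pos _).le)).add
    (hVV.smul (sub_nonneg.2 hle))
  have := isSeparable_kronecker_self_add_smul (h.left_hermitian i.succ) hV (hVγV i)
  rw [h.trace_mul, if_pos rfl] at this
  simpa [← Complex.coe_smul] using this

theorem isSeparable_of_isWeakIrreducible {A : TMat k k} {c : Fin (n + 1) → ℝ}
    {γ : Fin (n + 1) → Matrix (Fin k) (Fin k) ℂ} {μ : ℝ} (hA : IsWeakIrreducible A)
    (h : IsHermitianSchmidt A c γ γ) (hc : ∀ i, c i ≤ c 0)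
    (hμ : IsLeastPosEigenvalue (γ 0 ⊗ₖ γ 0) μ) (hle : (∑ i : Fin n, c i.succ) / 2 ≤ c 0 * μ) :
    IsSeparable A := by
  obtain ⟨P, V, hP, hV, hγP, hVγV⟩ := h.exists_posSemidef_isRangeProjection hA hc
  refine h.isSeparable_of_leading hV.isStarProjection (fun i => hVγV i.succ) ?_ hle
  rw [hγP] at hμ ⊢
  exact isSeparable_kronecker_self_sub_smul hP hV hμ

end Criterion

section Pauli

lemma inv_sqrt_two_mul_self : ((√2 : ℝ) : ℂ)⁻¹ * ((√2 : ℝ) : ℂ)⁻¹ = 1 / 2 := by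
  rw [← mul_inv, ← Complex.ofReal_mul, Real.mul_self_sqrt zero_le_two, one_div,
    Complex.ofReal_ofNat]

lemma normalizedPauli_isHermitian (i : Fin 4) : (normalizedPauli i).IsHermitian := by
  ext a b
  fin_cases i <;> fin_cases a <;> fin_cases b <;> simp [normalizedPauli]

lemma normalizedPauli_trace_mul (i j : Fin 4) :
    (normalizedPauli i * normalizedPauli j).trace = if i = j then 1 else 0 := by
  fin_cases i <;> fin_cases j <;>
    norm_num [normalizedPauli, trace_fin_two, mul_mul_mul_comm _ Complex.I, inv_sqrt_two_mul_self]

lemma normalizedPauli_succ_trace (i : Fin 3) : (normalizedPauli i.succ).trace = 0 := by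
  fin_cases i <;> simp [normalizedPauli, trace_fin_two]

lemma normalizedPauli_zero_kronecker_self :
    normalizedPauli 0 ⊗ₖ normalizedPauli 0 = (1 / 2 : ℝ) • (1 : TMat 2 2) := by
  have zero_eq : normalizedPauli 0 = ((√2 : ℝ) : ℂ)⁻¹ • (1 : Matrix (Fin 2) (Fin 2) ℂ) := by
    rw [one_fin_two]
    rfl
  rw [zero_eq, smul_kronecker, kronecker_smul, smul_smul, inv_sqrt_two_mul_self, one_kronecker_one,
    ← Complex.coe_smul, Complex.ofReal_div, Complex.ofReal_one, Complex.ofReal_ofNat]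

lemma isLeastPosEigenvalue_normalizedPauli_zero :
    IsLeastPosEigenvalue (normalizedPauli 0 ⊗ₖ normalizedPauli 0) (1 / 2) := by
  have hasEigenvalue_iff (x : ℝ) : Module.End.HasEigenvalue
      (toLin' (normalizedPauli 0 ⊗ₖ normalizedPauli 0)) (x : ℂ) ↔ x = 1 / 2 := by
    rw [Module.End.hasEigenvalue_iff_mem_spectrum, spectrum_toLin',
      normalizedPauli_zero_kronecker_self, ← Complex.coe_smul, ← Algebra.algebraMap_eq_smul_one,
      spectrum.scalar_eq, Set.mem_singleton_iff, Complex.ofReal_inj]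
  exact ⟨⟨by norm_num, (hasEigenvalue_iff _).2 rfl⟩,
    fun x hx => ((hasEigenvalue_iff x).1 hx.2).ge⟩

lemma isHermitianSchmidt_pauliMatrix {c : Fin 4 → ℝ} (hc : ∀ i, 0 < c i) :
    IsHermitianSchmidt (pauliMatrix c) c normalizedPauli normalizedPauli := by
  have orthonormal : IsOrthonormalFamily normalizedPauli := fun i j => by
    rw [normalizedPauli_isHermitian j, normalizedPauli_trace_mul]
  exact ⟨hc, normalizedPauli_isHermitian, normalizedPauli_isHermitian, orthonormal, orthonormal,
    rfl⟩

lemma flipTrace_pauliMatrix (c : Fin 4 → ℝ) :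
    flipTrace (pauliMatrix c) = ((∑ i, c i : ℝ) : ℂ) := by
  simp [pauliMatrix, flipTrace_kronecker, normalizedPauli_trace_mul]

lemma trace_pauliMatrix (c : Fin 4 → ℝ) : (pauliMatrix c).trace = ((2 * c 0 : ℝ) : ℂ) := by
  have trace_succ (i : Fin 3) :
      (normalizedPauli i.succ ⊗ₖ normalizedPauli i.succ).trace = 0 := by
    rw [trace_kronecker, normalizedPauli_succ_trace, mul_zero]
  have trace_zero : (normalizedPauli 0 ⊗ₖ normalizedPauli 0).trace = 2 := by
    rw [normalizedPauli_zero_kronecker_self, trace_smul, trace_one, ← Complex.coe_smul]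
    norm_num
  rw [pauliMatrix, Fin.sum_univ_succ, trace_add, trace_sum]
  simp [trace_smul, trace_succ, trace_zero, mul_comm]

lemma isSeparable_pauliMatrix_iff {c : Fin 4 → ℝ} (hc : ∀ i, 0 < c i) :
    IsSeparable (pauliMatrix c) ↔ c 1 + c 2 + c 3 ≤ c 0 := by
  constructor
  · intro hsep
    have hle := flipTrace_le_trace hsep.posSemidef
    rw [flipTrace_pauliMatrix, trace_pauliMatrix, Complex.real_le_real, Fin.sum_univ_four] at hle
    linarith
  · intro hle
    refine (isHermitianSchmidt_pauliMatrix hc).isSeparable_of_leading (V := 1) (μ := 1 / 2)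
      (.one _) (fun i => by rw [Matrix.one_mul, Matrix.mul_one]) ?_ ?_
    · rw [normalizedPauli_zero_kronecker_self, one_kronecker_one, sub_self]
      exact .zero
    · have sum_eq : ∑ i : Fin 3, c i.succ = c 1 + c 2 + c 3 := Fin.sum_univ_three _
      linarith

end Pauli

end Bipartite

theorem mainTheorem8 :
    (∀ (k n : ℕ) (A : Bipartite.TMat k k) (c : Fin (n + 1) → ℝ)
        (γ : Fin (n + 1) → Matrix (Fin k) (Fin k) ℂ) (μ : ℝ),
      Bipartite.IsSPC A → Bipartite.IsWeakIrreducible A →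
      Bipartite.IsHermitianSchmidt A c γ γ → Antitone c →
      Bipartite.IsLeastPosEigenvalue (γ 0 ⊗ₖ γ 0) μ →
      -- for one term (`n = 0`) there is nothing to divide by and the condition is void
      (n = 0 ∨ 1 / 2 ≤ c 0 * μ / ∑ i : Fin n, c i.succ) →
      Bipartite.IsSeparable A) ∧
    (Bipartite.IsLeastPosEigenvalue
        (Bipartite.normalizedPauli 0 ⊗ₖ Bipartite.normalizedPauli 0) (1 / 2) ∧
      ∀ c : Fin 4 → ℝ, (∀ i, 0 < c i) →
        Bipartite.IsHermitianSchmidt (Bipartite.pauliMatrix c) c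
          Bipartite.normalizedPauli Bipartite.normalizedPauli ∧
        (Bipartite.IsSeparable (Bipartite.pauliMatrix c) ↔
          1 / 2 ≤ c 0 * (1 / 2) / (c 1 + c 2 + c 3))) := by
  refine ⟨fun k n A c γ μ _ hA h hc hμ hle => ?_,
    Bipartite.isLeastPosEigenvalue_normalizedPauli_zero, fun c hc => ⟨
      Bipartite.isHermitianSchmidt_pauliMatrix hc, ?_⟩⟩
  · refine Bipartite.isSeparable_of_isWeakIrreducible hA h (fun i => hc (Fin.zero_le i)) hμ ?_
    have hpos : 0 < c 0 * μ := mul_pos (h.coeff_pos 0) hμ.1.1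
    rcases n.eq_zero_or_pos with rfl | hn
    · simpa using hpos.le
    have : NeZero n := ⟨hn.ne'⟩
    have hsum : 0 < ∑ i : Fin n, c i.succ :=
      Finset.sum_pos (fun i _ => h.coeff_pos i.succ) Finset.univ_nonempty
    linarith [(le_div_iff₀ hsum).1 (hle.resolve_left hn.ne')]
  · have hsum : 0 < c 1 + c 2 + c 3 := add_pos (add_pos (hc 1) (hc 2)) (hc 3)
    rw [Bipartite.isSeparable_pauliMatrix_iff hc, le_div_iff₀ hsum]
    constructor <;> intro h <;> linarith
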